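/- **Model.** A hypergraph on $n$ vertices is $H=(V,E)$ with $V=\{0,\dots,n-1\}$ and $E$ a set of non-empty subsets of $V$. For non-empty $U\subseteq V$ let $E[U]=\{e\cap U : e\in E,\ |e\cap U|\ge 2\}$ (a set, without repetitions), and let the maximum density of $H$ be $$\mu(H)=\max_{\emptyset\ne U\subseteq V}\ \frac1{|U|}\sum_{f\in E[U]}|f| .$$ A (simple) triangle is a cycle $v_0,e_0,v_1,e_1,v_2,e_2$ with distinct vertices $v_i$, distinct hyperedges $e_i\in E$ and $v_i\in e_{i-1}\cap e_i$ (indices modulo $3$); cycles differing by rotation or reversal are the same triangle. It is induced if moreover $v_i\notin e_{i+1}$ for all $i$. In triangle enumeration every vertex $v$ outputs a set $S_v$ of triangles so that the $S_v$ are pairwise disjoint and their union is the set of all simple triangles of $H$ (or, in the second variant, of all induced triangles of $H$). In the PC (PRIMAL CONGEST) model with bandwidth $B$, every vertex initially knows $n$, its own identifier and the vertex lists of the hyperedges containing it. In each synchronous round it may send to each other vertex sharing a hyperedge with it a (possibly different) message of $B$ bits, or no message. Local computation is unrestricted and algorithms may be randomized, even with randomness shared by all vertices. Each vertex decides when to produce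 its output, which is then final; the number of rounds of an execution is the number of rounds after which all vertices have produced their output ($\infty$ if this never happens). **Theorem.** There is an absolute constant $p_0\in(0,1)$ such that the following holds for both variants of triangle enumeration. For every $\varepsilon>0$, every $K\in\mathbb N$ and every $b>0$ there are constants $c,a,\mu_0>0$, depending only on $\varepsilon,K,b$, such that for all $n,B\in\mathbb N$ and all real $\mu$ with $\mu_0\le\mu\le n^{K}$ and $B\le b\log n$: if $\mathcal A$ is an algorithm in the PC model with bandwidth $B$ that solves triangle enumeration with probability at least $p_0$ on every $n$-vertex hypergraph $H$ with $a\mu\le\mu(H)\le\mu$, then there is an $n$-vertex hypergraph $H$ with $a\mu\le\mu(H)\le\mu$ on which the expected number of rounds of $\mathcal A$ is at least $$c\,\frac{\mu^{1-\varepsilon}}{\log n}.$$ In other words, for $\mu$ polynomially bounded in $n$ and $B=O(\log n)$, solving triangle enumeration with sufficiently high constant probability on hypergraphs with maximum density $\Theta(\mu)$ requires $\Omega(\mu^{1-\varepsilon}/\log n)$ rounds. -/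

import Mathlib

open MeasureTheory

/-! ### Density of hypergraphs -/

namespace Hypergraph

/-- A network with vertex set `{0, …, n - 1}`: every element of `Fin n` is a vertex, and hyperedges
are non-empty. -/
structure IsNetwork {n : ℕ} (H : Hypergraph (Fin n)) : Prop where
  vertexSet_eq : H.vertexSet = Set.univ
  nonempty_of_mem : ∀ e ∈ H.edgeSet, e.Nonempty

/-- The edge set `E[U] = {e ∩ U | e ∈ E, |e ∩ U| ≥ 2}` of the restriction of `H` to `U`. It is a
set, so equal traces of different hyperedges are counted once. -/
def restrictedEdges {α : Type*} (H : Hypergraph α) (U : Set α) : Set (Set α) :=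
  {f | 2 ≤ f.ncard ∧ ∃ e ∈ H.edgeSet, f = e ∩ U}

/-- `μ_H(U) = (1 / |U|) ∑_{e ∈ E[U]} |e|` (used for finite hypergraphs and non-empty `U`). -/
noncomputable def density {α : Type*} (H : Hypergraph α) (U : Set α) : ℝ :=
  (∑ᶠ e ∈ H.restrictedEdges U, (e.ncard : ℝ)) / (U.ncard : ℝ)

/-- The maximum density `μ(H) = max_U μ_H(U)` over non-empty sets `U` of vertices. (On a finite
vertex type this is a supremum over finitely many sets.) -/
noncomputable def maxDensity {α : Type*} (H : Hypergraph α) : ℝ :=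
  ⨆ U : {U : Set α // U.Nonempty ∧ U ⊆ H.vertexSet}, H.density U.1

/-- The hyperedges containing `v`. -/
def incidentEdges {α : Type*} (H : Hypergraph α) (v : α) : Set (Set α) :=
  {e | e ∈ H.edgeSet ∧ v ∈ e}

end Hypergraph

/-! ### Triangles -/

/-- A cyclic sequence `(v 0, e 0, v 1, e 1, v 2, e 2)` of three vertices and three sets. -/
@[ext]
structure HyperTriangle (n : ℕ) where
  v : Fin 3 → Fin n
  e : Fin 3 → Set (Fin n)

/-- The two variants of the enumeration task: all simple triangles, or all induced ones. -/
inductive TriangleKind where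
  | simple
  | induced

/-- `T` is a simple closed path of length three in `H`: the vertices are distinct, the hyperedges
are distinct, and `v i ∈ e (i - 1) ∩ e i` (indices modulo 3). The six sequences that arise from each
other by rotation and reversal describe the same triangle; exactly one of them has
`v 0 < v 1 < v 2`, and it is used as the name of the triangle. -/
structure HyperTriangle.IsSimple {n : ℕ} (T : HyperTriangle n) (H : Hypergraph (Fin n)) :
    Prop where
  vertices_lt : T.v 0 < T.v 1 ∧ T.v 1 < T.v 2
  edges_injective : Function.Injective T.e
  edges_mem : ∀ i, T.e i ∈ H.edgeSet
  vertex_mem : ∀ i, T.v i ∈ T.e i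
  succ_vertex_mem : ∀ i, T.v (i + 1) ∈ T.e i

/-- `T` is a triangle of `H` of the given kind. An induced triangle is a simple one in which every
vertex avoids the opposite hyperedge. -/
def HyperTriangle.IsTriangle {n : ℕ} (T : HyperTriangle n) (H : Hypergraph (Fin n)) :
    TriangleKind → Prop
  | .simple => T.IsSimple H
  | .induced => T.IsSimple H ∧ ∀ i, T.v i ∉ T.e (i + 1)

/-! ### The PRIMAL CONGEST model -/

/-- In one round a vertex sends to a neighbour a `B`-bit message, or nothing (`none`). -/
abbrev PCMessage (B : ℕ) : Type := Option (Fin B → Bool)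

/-- What a vertex has received so far, the latest round first: for each round, the message received
from each vertex. -/
abbrev PCHistory (n B : ℕ) : Type := List (Fin n → PCMessage B)

/-- A randomized algorithm for `n`-vertex networks in the PRIMAL CONGEST model with `B`-bit
messages; `Ω` is the space of random seeds. Vertex `v` knows its identifier `v`, the set of
hyperedges that contain it, each given by its list of vertices (initial knowledge `KT₁`), the
randomness, and the messages received so far. From these it computes, without any restriction on
local computation, the message for each other vertex and, possibly, its output.

The whole seed is available to every vertex. Private coins are the case in which `Ω` is a product
and `v` reads its own coordinate only; deterministic algorithms are the case of constant dependence
on the seed. -/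
structure PCAlgorithm (n B : ℕ) (Ω : Type*) [MeasurableSpace Ω] where
  /-- `send v E ω h w` is the message from `v` to `w` in the next round. -/
  send : Fin n → Set (Set (Fin n)) → Ω → PCHistory n B → Fin n → PCMessage B
  /-- `output v E ω h` is the set of triangles that `v` outputs, `none` if it does not yet do so. -/
  output : Fin n → Set (Set (Fin n)) → Ω → PCHistory n B → Option (Set (HyperTriangle n))
  measurableSet_send : ∀ v E h w m, MeasurableSet {ω | send v E ω h w = m}
  measurableSet_output : ∀ v E h S, MeasurableSet {ω | output v E ω h = S}

namespace PCAlgorithm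

variable {n B : ℕ} {Ω : Type*} [MeasurableSpace Ω]

open Classical in
/-- The messages received by `v` in the first `t` rounds of the execution on `H` with seed `ω`.
Messages are delivered only between distinct vertices that share a hyperedge. -/
noncomputable def history (A : PCAlgorithm n B Ω) (H : Hypergraph (Fin n)) (ω : Ω) :
    ℕ → Fin n → PCHistory n B
  | 0, _ => []
  | t + 1, v =>
      (fun u => if u ≠ v ∧ H.Adj u v then
          A.send u (H.incidentEdges u) ω (A.history H ω t u) v
        else none) :: A.history H ω t v

/-- What `v` has to output after `t` rounds, if anything. -/
noncomputable def outputAt (A : PCAlgorithm n B Ω) (H : Hypergraph (Fin n)) (ω : Ω) (v : Fin n)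
    (t : ℕ) : Option (Set (HyperTriangle n)) :=
  A.output v (H.incidentEdges v) ω (A.history H ω t v)

/-- Vertex `v` outputs `S`, and does so after exactly `t` rounds. The first output is final. -/
def Answers (A : PCAlgorithm n B Ω) (H : Hypergraph (Fin n)) (ω : Ω) (v : Fin n) (t : ℕ)
    (S : Set (HyperTriangle n)) : Prop :=
  A.outputAt H ω v t = some S ∧ ∀ s < t, A.outputAt H ω v s = none

/-- The execution with seed `ω` enumerates the triangles of `H`: every vertex eventually outputs a
set, the sets are pairwise disjoint, and their union is the set of all triangles of `H`. -/
def Enumerates (A : PCAlgorithm n B Ω) (k : TriangleKind) (H : Hypergraph (Fin n)) (ω : Ω) : Prop :=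
  ∃ S : Fin n → Set (HyperTriangle n),
    (∀ v, ∃ t, A.Answers H ω v t (S v)) ∧
    Pairwise (fun u v => Disjoint (S u) (S v)) ∧
    ⋃ v, S v = {T | T.IsTriangle H k}

/-- The number of rounds after which all vertices have output (`∞` if this never happens). -/
noncomputable def rounds (A : PCAlgorithm n B Ω) (H : Hypergraph (Fin n)) (ω : Ω) : ENNReal :=
  ⨅ t : ℕ, ⨅ _ : ∀ v, ∃ s ≤ t, ∃ S, A.Answers H ω v s S, (t : ENNReal)

/-- `A` solves triangle enumeration on `H` with probability at least `p`, the seed being drawn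
from `P`. -/
def SolvesWithProb (A : PCAlgorithm n B Ω) (P : Measure Ω) (k : TriangleKind) (p : ℝ)
    (H : Hypergraph (Fin n)) : Prop :=
  ENNReal.ofReal p ≤ P {ω | A.Enumerates k H ω}

/-- The expected number of rounds of `A` on `H`, the seed being drawn from `P`. -/
noncomputable def expectedRounds (A : PCAlgorithm n B Ω) (P : Measure Ω)
    (H : Hypergraph (Fin n)) : ENNReal :=
  ∫⁻ ω, A.rounds H ω ∂P

end PCAlgorithm

/-! ### Layered hypergraphs -/

/-! The bound compares information with bandwidth. Edges have rank `d + 2`: an edge of type `i`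
picks one site from corner layers `i` and `i + 1` and from each of `d` layers private to the type. A
site then lies in up to about `q ^ (d + 1)` edges, but it can receive messages from only `3 * (d +
1) * q` sites. Let `x` be a uniformly random set of such edges.

There are `q ^ (3 * d + 3)` potential cornered triangles, each present with probability 1/8, and one
edge lies in at most `q ^ (2 * d + 1)` of them. No site meets all three types, so every triangle
that a site outputs reveals an edge not incident to it. On average a site must thus learn of order
`q ^ (d + 1) / d` foreign edges from its messages, at most about `(B + 1) * 3 * (d + 1) * q` bits
per round. This forces order `q ^ d / (B + 1)` rounds for fixed `d`. As the density is of order `q ^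
(d + 1)`, this is `μ ^ (d / (d + 1)) / log n`, and `d + 1 ≥ 1 / ε` suffices.

`card_mul_two_pow_le` replaces entropy by an injection, `pow_le_of_shares` does the triangle count,
and `pow_le_of_enumerates` applies it to an execution with a fixed seed. `pow_le_of_solvesWithProb`
fixes the seed by averaging, as in Yao's principle. A second, complete copy of the site space keeps
the density up for every `x`; it is not connected to the first copy and carries no information about
`x`. -/

namespace LayeredHypergraph

variable {n d q : ℕ}

/-- Layers of vertices: three corner layers and, for each of the three edge types, `d` layers that
only edges of this type meet. -/
abbrev Layer (d : ℕ) : Type := Fin 3 ⊕ Fin 3 × Fin d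

/-- A layer consists of `q` sites. -/
abbrev Site (d q : ℕ) : Type := Layer d × Fin q

/-- An edge meets two corner layers and `d` further layers, one slot for each. -/
abbrev Slot (d : ℕ) : Type := Bool ⊕ Fin d

/-- The type of an edge, and its site in each of its slots. -/
abbrev Code (d q : ℕ) : Type := Fin 3 × (Slot d → Fin q)

/-- The layer that belongs to a slot of an edge of type `i`. -/
def layer (i : Fin 3) : Slot d → Layer d
  | .inl false => .inl i
  | .inl true => .inl (i + 1)
  | .inr k => .inr (i, k)

theorem layer_injective (i : Fin 3) : Function.Injective (layer (d := d) i) := by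
  have key : i ≠ i + 1 := by decide +revert
  rintro ((_ | _) | k) ((_ | _) | l) h <;> simp_all [layer]

/-- Two of the three corner layers determine the type whose edges meet both. -/
theorem type_eq_of_layer_eq {i j : Fin 3} {p r : Slot d} (hp : layer i (.inl false) = layer j p)
    (hr : layer i (.inl true) = layer j r) : i = j := by
  rcases p with (_ | _) | p <;> rcases r with (_ | _) | r <;>
    simp only [layer, Sum.inl.injEq, reduceCtorEq] at hp hr <;> revert i j <;> decide

/-- The hyperedge with code `g` in the copy `s` of the site space, placed by `φ`. -/
def edge (φ : Bool × Site d q → Fin n) (s : Bool) (g : Code d q) : Set (Fin n) :=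
  Set.range fun p => φ (s, layer g.1 p, g.2 p)

/-- The hypergraph with the edges coded by `x` in the first copy of the site space, and all edges in
the second copy. -/
def network (φ : Bool × Site d q → Fin n) (x : Finset (Code d q)) : Hypergraph (Fin n) where
  vertexSet := Set.univ
  edgeSet := edge φ false '' x ∪ Set.range (edge φ true)
  subset_vertexSet_of_mem_edgeSet' := fun _ _ => Set.subset_univ _

theorem isNetwork_network (φ : Bool × Site d q → Fin n) (x : Finset (Code d q)) :
    (network φ x).IsNetwork where
  vertexSet_eq := rfl
  nonempty_of_mem := by
    rintro e (⟨g, -, rfl⟩ | ⟨g, rfl⟩) <;> exact Set.range_nonempty _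

theorem mem_edge {φ : Bool × Site d q → Fin n} (hφ : Function.Injective φ) {s t : Bool}
    {g : Code d q} {w : Site d q} :
    φ (t, w) ∈ edge φ s g ↔ t = s ∧ ∃ p, w = (layer g.1 p, g.2 p) := by
  constructor
  · rintro ⟨p, hp⟩
    have := hφ hp
    simp only [Prod.mk.injEq] at this
    exact ⟨this.1.symm, p, by simp [← this.2]⟩
  · rintro ⟨rfl, p, rfl⟩
    exact ⟨p, rfl⟩

theorem edge_inj {φ : Bool × Site d q → Fin n} (hφ : Function.Injective φ) {s t : Bool}
    {g h : Code d q} (e : edge φ s g = edge φ t h) : s = t ∧ g = h := by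
  have key : ∀ p, s = t ∧ ∃ p', (layer g.1 p, g.2 p) = (layer h.1 p', h.2 p') := fun p =>
    (mem_edge hφ).1 (e ▸ (mem_edge hφ).2 ⟨rfl, p, rfl⟩)
  refine ⟨(key (.inl false)).1, ?_⟩
  have h1 : g.1 = h.1 := by
    obtain ⟨-, p, hp⟩ := key (.inl false)
    obtain ⟨-, r, hr⟩ := key (.inl true)
    exact type_eq_of_layer_eq (congrArg Prod.fst hp) (congrArg Prod.fst hr)
  refine Prod.ext h1 (funext fun p => ?_)
  obtain ⟨-, p', hp⟩ := key p
  rw [h1, Prod.mk.injEq] at hp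
  obtain rfl := layer_injective _ hp.1
  exact hp.2

theorem edge_mem_network {φ : Bool × Site d q → Fin n} (hφ : Function.Injective φ)
    {x : Finset (Code d q)} {g : Code d q} :
    edge φ false g ∈ (network φ x).edgeSet ↔ g ∈ x := by
  constructor
  · rintro (⟨h, hx, e⟩ | ⟨h, e⟩)
    · obtain ⟨-, rfl⟩ := edge_inj hφ e
      exact hx
    · exact absurd (edge_inj hφ e).1 (by simp)
  · exact fun h => Or.inl ⟨g, h, rfl⟩

theorem card_site : Fintype.card (Site d q) = 3 * (d + 1) * q := by
  simp only [Fintype.card_prod, Fintype.card_sum, Fintype.card_fin]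
  ring

/-! ### Density -/

/-- Every trace through `u` of an edge of a layered hypergraph is of this form. -/
def traceOf (φ : Bool × Site d q → Fin n) (u : Fin n)
    (c : Bool × Fin 3 × Σ p₀ : Slot d, ({p : Slot d // p ≠ p₀} → Option (Fin q))) : Set (Fin n) :=
  insert u {y | ∃ p j, c.2.2.2 p = some j ∧ y = φ (c.1, layer c.2.1 p, j)}

theorem exists_traceOf (φ : Bool × Site d q → Fin n) (x : Finset (Code d q)) {U f : Set (Fin n)}
    {u : Fin n} (hf : f ∈ (network φ x).restrictedEdges U) (hu : u ∈ f) :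
    ∃ c, traceOf φ u c = f := by
  classical
  obtain ⟨-, e, he, rfl⟩ := hf
  obtain ⟨s, g, rfl⟩ : ∃ s g, e = edge φ s g := by
    rcases he with ⟨g, -, rfl⟩ | ⟨g, rfl⟩
    · exact ⟨_, g, rfl⟩
    · exact ⟨_, g, rfl⟩
  obtain ⟨⟨p₀, rfl⟩, huU⟩ := hu
  refine ⟨(s, g.1, ⟨p₀, fun p => if φ (s, layer g.1 p, g.2 p) ∈ U then some (g.2 p) else none⟩), ?_⟩
  ext y
  simp only [traceOf, Set.mem_insert_iff, Set.mem_ofPred_eq, Set.mem_inter_iff]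
  constructor
  · rintro (rfl | ⟨p, j, h, rfl⟩)
    · exact ⟨⟨p₀, rfl⟩, huU⟩
    · split_ifs at h with hU
      simp only [Option.some.injEq] at h
      subst h
      exact ⟨⟨p, rfl⟩, hU⟩
  · rintro ⟨⟨p, rfl⟩, hU⟩
    by_cases hp : p = p₀
    · subst hp
      exact Or.inl rfl
    · refine Or.inr ⟨⟨p, hp⟩, g.2 p, ?_, rfl⟩
      simp only [ite_eq_left_iff, reduceCtorEq, imp_false, not_not]
      exact hU

/-- Double counting: the sum of the sizes of the traces is the sum over `u ∈ U` of the number of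
traces through `u`. Such a trace is given by the copy (2), the type (3), the slot of `u` (`d + 2`),
and for each of the other `d + 1` slots a site or its absence (`q + 1`). -/
theorem density_network_le (φ : Bool × Site d q → Fin n) (x : Finset (Code d q))
    {U : Set (Fin n)} (hU : U.Nonempty) :
    (network φ x).density U ≤ 6 * (d + 2) * (q + 1) ^ (d + 1) := by
  classical
  set E := (network φ x).restrictedEdges U with hE
  have hcard : ∀ u, (E.toFinset.filter fun f => u ∈ f).card ≤ 6 * (d + 2) * (q + 1) ^ (d + 1) := by
    intro u
    have h1 : (E.toFinset.filter fun f => u ∈ f) ⊆ Finset.univ.image (traceOf φ u) := by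
      intro f hf
      simp only [Finset.mem_filter, Set.mem_toFinset] at hf
      obtain ⟨c, hc⟩ := exists_traceOf φ x hf.1 hf.2
      exact Finset.mem_image.2 ⟨c, Finset.mem_univ _, hc⟩
    refine (Finset.card_le_card h1).trans (Finset.card_image_le.trans ?_)
    rw [Finset.card_univ]
    simp only [Fintype.card_prod, Fintype.card_bool, Fintype.card_fin, Fintype.card_sigma,
      Fintype.card_fun, Fintype.card_option, Fintype.card_subtype_compl, Fintype.card_sum,
      Fintype.card_unique, Finset.sum_const, Finset.card_univ, smul_eq_mul]
    rw [show 2 + d - 1 = d + 1 by omega]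
    exact le_of_eq (by ring)
  have hsum : ∑ᶠ e ∈ E, (e.ncard : ℝ) = ∑ f ∈ E.toFinset, (f.ncard : ℝ) := by
    rw [← finsum_mem_coe_finset, Set.coe_toFinset]
  have hnc : ∀ f ∈ E.toFinset, f.ncard = ∑ u ∈ U.toFinset, if u ∈ f then 1 else 0 := by
    intro f hf
    rw [← Finset.card_filter, ← Set.ncard_coe_finset]
    congr 1
    ext y
    obtain ⟨-, e, -, rfl⟩ := Set.mem_toFinset.1 hf
    simp +contextual
  have hle : ∑ f ∈ E.toFinset, f.ncard ≤ U.ncard * (6 * (d + 2) * (q + 1) ^ (d + 1)) := by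
    rw [Finset.sum_congr rfl hnc, Finset.sum_comm, Set.ncard_eq_toFinset_card', ← smul_eq_mul]
    refine Finset.sum_le_card_nsmul _ _ _ fun u _ => ?_
    rw [← Finset.card_filter]
    exact hcard u
  have hpos : (0 : ℝ) < U.ncard := by
    exact_mod_cast (Set.ncard_pos (Set.toFinite U)).2 hU
  rw [Hypergraph.density, ← hE, hsum, div_le_iff₀ hpos]
  have : (∑ f ∈ E.toFinset, (f.ncard : ℝ)) ≤ U.ncard * (6 * (d + 2) * (q + 1) ^ (d + 1)) := by
    exact_mod_cast hle
  linarith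

theorem maxDensity_network_le (φ : Bool × Site d q → Fin n) (x : Finset (Code d q)) :
    (network φ x).maxDensity ≤ 6 * (d + 2) * (q + 1) ^ (d + 1) :=
  Real.iSup_le (fun U => density_network_le φ x U.2.1) (by positivity)

theorem ncard_edge {φ : Bool × Site d q → Fin n} (hφ : Function.Injective φ) (s : Bool)
    (g : Code d q) : (edge φ s g).ncard = d + 2 := by
  rw [edge, ← Set.image_univ, Set.ncard_image_of_injective, Set.ncard_univ, Nat.card_eq_fintype_card]
  · simp [add_comm]
  · intro p r h
    have := hφ h
    simp only [Prod.mk.injEq, true_and] at this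
    exact layer_injective _ this.1

/-- The second copy alone suffices, whatever `x` is: `3 * q ^ (d + 2)` edges of size `d + 2` on `3 *
(d + 1) * q` sites. -/
theorem le_maxDensity_network {φ : Bool × Site d q → Fin n} (hφ : Function.Injective φ)
    (x : Finset (Code d q)) (hq : 0 < q) : (q : ℝ) ^ (d + 1) ≤ (network φ x).maxDensity := by
  classical
  set U : Set (Fin n) := Set.range fun w => φ (true, w) with hU
  have hUne : U.Nonempty := ⟨_, ⟨(.inl 0, ⟨0, hq⟩), rfl⟩⟩
  have hbdd : BddAbove (Set.range fun U : {U : Set (Fin n) // U.Nonempty ∧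
      U ⊆ (network φ x).vertexSet} => (network φ x).density U.1) := (Set.toFinite _).bddAbove
  refine le_trans ?_ (le_ciSup hbdd ⟨U, hUne, Set.subset_univ _⟩)
  have hUcard : U.ncard = 3 * (d + 1) * q := by
    rw [hU, ← Set.image_univ, Set.ncard_image_of_injective, Set.ncard_univ,
      Nat.card_eq_fintype_card, card_site]
    intro a b h
    simpa using hφ h
  set E := (network φ x).restrictedEdges U with hE
  have hsub : Finset.univ.image (edge φ true) ⊆ E.toFinset := by
    intro f hf
    obtain ⟨g, -, rfl⟩ := Finset.mem_image.1 hf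
    rw [Set.mem_toFinset]
    refine ⟨by rw [ncard_edge hφ]; omega, edge φ true g, Or.inr ⟨g, rfl⟩, ?_⟩
    rw [eq_comm, Set.inter_eq_left]
    rintro _ ⟨p, rfl⟩
    exact ⟨_, rfl⟩
  have hsum : ∑ᶠ e ∈ E, (e.ncard : ℝ) = ∑ f ∈ E.toFinset, (f.ncard : ℝ) := by
    rw [← finsum_mem_coe_finset, Set.coe_toFinset]
  have hge : 3 * q ^ (d + 2) * (d + 2) ≤ ∑ f ∈ E.toFinset, f.ncard := by
    refine le_trans ?_ (Finset.sum_le_sum_of_subset hsub)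
    rw [Finset.sum_image fun a _ b _ h => (edge_inj hφ h).2]
    simp only [ncard_edge hφ, Finset.sum_const, smul_eq_mul, Finset.card_univ, Fintype.card_prod,
      Fintype.card_fin, Fintype.card_fun, Fintype.card_sum, Fintype.card_bool]
    rw [add_comm 2 d]
  rw [Hypergraph.density, ← hE, hsum, hUcard, le_div_iff₀ (by positivity)]
  have h1 : (3 * q ^ (d + 2) * (d + 2) : ℝ) ≤ ∑ f ∈ E.toFinset, (f.ncard : ℝ) := by
    exact_mod_cast hge
  refine le_trans ?_ h1
  push_cast
  have : (0 : ℝ) ≤ 3 * q ^ (d + 2) := by positivity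
  rw [show (q : ℝ) ^ (d + 1) * (3 * (d + 1) * q) = 3 * q ^ (d + 2) * (d + 1) by ring]
  gcongr
  norm_num

end LayeredHypergraph

namespace LayeredHypergraph

variable {n d q : ℕ}

/-! ### Cornered triangles -/

/-- A triangle with one vertex in each corner layer, given by its corners and by the remaining sites
of its three edges. -/
abbrev Pattern (d q : ℕ) : Type := (Fin 3 → Fin q) × (Fin 3 → Fin d → Fin q)

/-- The code of the `i`-th edge of a pattern. -/
def side (p : Pattern d q) (i : Fin 3) : Code d q :=
  (i, Sum.elim (fun b => p.1 (if b then i + 1 else i)) (p.2 i))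

/-- The triangle described by a pattern. -/
def triangle (φ : Bool × Site d q → Fin n) (p : Pattern d q) : HyperTriangle n where
  v i := φ (false, .inl i, p.1 i)
  e i := edge φ false (side p i)

/-- The edge with code `g` contains the site `w`. -/
def Meets (w : Site d q) (g : Code d q) : Prop := ∃ p, w = (layer g.1 p, g.2 p)

theorem meets_iff {φ : Bool × Site d q → Fin n} (hφ : Function.Injective φ) {w : Site d q}
    {g : Code d q} : φ (false, w) ∈ edge φ false g ↔ Meets w g := by
  rw [mem_edge hφ]
  simp [Meets]

theorem side_injective (p : Pattern d q) : Function.Injective (side p) :=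
  fun _ _ h => congrArg Prod.fst h

theorem meets_side_left (p : Pattern d q) (i : Fin 3) : Meets (.inl i, p.1 i) (side p i) :=
  ⟨.inl false, rfl⟩

theorem meets_side_right (p : Pattern d q) (i : Fin 3) :
    Meets (.inl (i + 1), p.1 (i + 1)) (side p i) :=
  ⟨.inl true, rfl⟩

/-- Corner layer `j` is missed by type `j + 1`, which uses the other two corners, and a private
layer of type `j` is missed by both other types. Hence each triangle has an edge that `w` does not
see. -/
theorem exists_type_not_meets (w : Site d q) : ∃ i, ∀ g : Code d q, g.1 = i → ¬ Meets w g := by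
  have h1 : ∀ j : Fin 3, j ≠ j + 1 ∧ j ≠ j + 1 + 1 := by decide
  rcases w with ⟨j | ⟨j, k⟩, a⟩
  · refine ⟨j + 1, ?_⟩
    rintro ⟨-, c⟩ rfl ⟨(_ | _) | p, hp⟩ <;> simp [layer, h1 j] at hp
  · refine ⟨j + 1, ?_⟩
    rintro ⟨-, c⟩ rfl ⟨(_ | _) | p, hp⟩ <;> simp [layer, h1 j] at hp

/-- A corner is never in the opposite edge, whose corner layers are the other two; so cornered
triangles serve both variants at once. -/
theorem isTriangle_triangle {φ : Bool × Site d q → Fin n} (hφ : Function.Injective φ)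
    (hlt : ∀ i j : Fin 3, i < j → ∀ a b, φ (false, .inl i, a) < φ (false, .inl j, b))
    {x : Finset (Code d q)} {p : Pattern d q} (hp : ∀ i, side p i ∈ x) (k : TriangleKind) :
    (triangle φ p).IsTriangle (network φ x) k := by
  have hs : (triangle φ p).IsSimple (network φ x) :=
    { vertices_lt := ⟨hlt _ _ (by decide) _ _, hlt _ _ (by decide) _ _⟩
      edges_injective := fun i j h => side_injective p (edge_inj hφ h).2
      edges_mem := fun i => (edge_mem_network hφ).2 (hp i)
      vertex_mem := fun i => (meets_iff hφ).2 (meets_side_left p i)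
      succ_vertex_mem := fun i => (meets_iff hφ).2 (meets_side_right p i) }
  cases k with
  | simple => exact hs
  | induced =>
    refine ⟨hs, fun i h => ?_⟩
    have h1 : ∀ j : Fin 3, j ≠ j + 1 ∧ j ≠ j + 1 + 1 := by decide
    obtain ⟨(_ | _) | r, hr⟩ := (meets_iff hφ).1 h <;> simp [layer, side, h1 i] at hr

theorem side_mem_of_isTriangle {φ : Bool × Site d q → Fin n} (hφ : Function.Injective φ)
    {x : Finset (Code d q)} {p : Pattern d q} {k : TriangleKind}
    (h : (triangle φ p).IsTriangle (network φ x) k) (i : Fin 3) : side p i ∈ x := by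
  have hs : (triangle φ p).IsSimple (network φ x) := by
    cases k with
    | simple => exact h
    | induced => exact h.1
  exact (edge_mem_network hφ).1 (hs.edges_mem i)

/-! ### Counting -/

theorem card_pattern : Fintype.card (Pattern d q) = q ^ (3 * d + 3) := by
  simp only [Fintype.card_prod, Fintype.card_fun, Fintype.card_fin]
  ring

open Classical in
theorem card_filter_side_mem (p : Pattern d q) :
    (Finset.univ.filter fun x : Finset (Code d q) => ∀ i, side p i ∈ x).card * 8 =
      2 ^ Fintype.card (Code d q) := by
  have h3 : (Finset.univ.image (side p)).card = 3 := by
    rw [Finset.card_image_of_injective _ (side_injective p)]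
    simp
  have h : (Finset.univ.filter fun x : Finset (Code d q) => ∀ i, side p i ∈ x) =
      Finset.Icc (Finset.univ.image (side p)) Finset.univ := by
    ext x
    simp [Finset.image_subset_iff]
  have hle := Finset.card_le_univ (Finset.univ.image (side p))
  rw [h, Finset.card_Icc_finset (Finset.subset_univ _), Finset.card_univ]
  rw [h3] at hle ⊢
  rw [show 8 = 2 ^ 3 by norm_num, ← pow_add]
  congr 1
  omega

open Classical in
-- Once side `i` is fixed, only the opposite corner and the `2 * d` private sites of the other two
-- sides are free.
theorem card_filter_side_eq_le (i : Fin 3) (g : Code d q) :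
    (Finset.univ.filter fun p : Pattern d q => side p i = g).card ≤ q ^ (2 * d + 1) := by
  have hcard : Fintype.card (Fin q × ({j : Fin 3 // j ≠ i} → Fin d → Fin q)) =
      q ^ (2 * d + 1) := by
    simp only [Fintype.card_prod, Fintype.card_fun, Fintype.card_fin, Fintype.card_subtype_compl,
      Fintype.card_unique]
    ring
  rw [← hcard, ← Finset.card_univ]
  refine Finset.card_le_card_of_injOn (fun p => (p.1 (i + 2), fun j k => p.2 j k))
    (fun _ _ => Finset.mem_coe.2 (Finset.mem_univ _)) ?_
  intro p hp r hr h
  simp only [Finset.coe_filter, Finset.mem_univ, true_and, Set.mem_ofPred_eq] at hp hr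
  simp only [Prod.mk.injEq] at h
  have hpr : (side p i).2 = (side r i).2 := by rw [hp, hr]
  have h0 : p.1 i = r.1 i := congrFun hpr (.inl false)
  have h1 : p.1 (i + 1) = r.1 (i + 1) := congrFun hpr (.inl true)
  have hj : ∀ i j : Fin 3, j = i ∨ j = i + 1 ∨ j = i + 2 := by decide
  refine Prod.ext (funext fun j => ?_) (funext fun j => ?_)
  · obtain rfl | rfl | rfl := hj i j
    exacts [h0, h1, h.1]
  · by_cases hji : j = i
    · subst hji
      exact funext fun k => congrFun hpr (.inr k)
    · exact congrFun h.2 ⟨j, hji⟩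

/-- If a key, together with the part of `x` in `O`, determines a subset `F x` of `x` outside of `O`,
then there are few `x` for which `F x` is large. -/
theorem card_mul_two_pow_le {E κ : Type*} [Fintype E] [DecidableEq E] [Fintype κ]
    (O : E → Prop) [DecidablePred O] (X : Finset (Finset E)) (F : Finset E → Finset E)
    (key : Finset E → κ) (M : ℕ) (hsub : ∀ x ∈ X, F x ⊆ x) (hO : ∀ x ∈ X, ∀ g ∈ F x, ¬ O g)
    (hdet : ∀ x ∈ X, ∀ y ∈ X, key x = key y → x.filter O = y.filter O → F x = F y)
    (hM : ∀ x ∈ X, M ≤ (F x).card) :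
    X.card * 2 ^ M ≤ Fintype.card κ * 2 ^ Fintype.card E := by
  -- Count pairs `(x, Z)` with `Z ⊆ F x`, encoded as `(key x, x \ Z)`. Deleting `Z` leaves the part
  -- in `O` intact, so the code determines `F x`, and then `x = (x \ Z) ∪ F x` and `Z`.
  have h1 : X.card * 2 ^ M ≤ (X.sigma fun x => (F x).powerset).card := by
    rw [Finset.card_sigma, ← smul_eq_mul]
    refine Finset.card_nsmul_le_sum _ _ _ fun x hx => ?_
    rw [Finset.card_powerset]
    exact Nat.pow_le_pow_right (by norm_num) (hM x hx)
  refine h1.trans ?_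
  rw [← Fintype.card_finset, ← Fintype.card_prod, ← Finset.card_univ]
  refine Finset.card_le_card_of_injOn (fun c => (key c.1, c.1 \ c.2))
    (fun _ _ => Finset.mem_coe.2 (Finset.mem_univ _)) ?_
  rintro ⟨x, Z⟩ hx ⟨y, Y⟩ hy h
  simp only [Finset.coe_sigma, Set.mem_sigma_iff, Finset.mem_coe, Finset.mem_powerset] at hx hy
  simp only [Prod.mk.injEq] at h
  have hown : ∀ x ∈ X, ∀ Z ⊆ F x, x.filter O = (x \ Z).filter O := by
    intro x hx Z hZ
    ext g
    have := hO x hx g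
    have := @hZ g
    simp only [Finset.mem_filter, Finset.mem_sdiff]
    tauto
  have hF : F x = F y :=
    hdet x hx.1 y hy.1 h.1 (by rw [hown x hx.1 Z hx.2, hown y hy.1 Y hy.2, h.2])
  have hrec : ∀ x ∈ X, ∀ Z ⊆ F x, x = (x \ Z) ∪ F x ∧ Z = F x \ (x \ Z) := by
    intro x hx Z hZ
    constructor <;> ext g <;> have := @hZ g <;> have := @hsub x hx g <;>
      simp only [Finset.mem_union, Finset.mem_sdiff] <;> tauto
  have hxy : x = y := by
    rw [(hrec x hx.1 Z hx.2).1, (hrec y hy.1 Y hy.2).1, h.2, hF]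
  have hZY : Z = Y := by
    rw [(hrec x hx.1 Z hx.2).2, (hrec y hy.1 Y hy.2).2, h.2, hF]
  rw [hxy, hZY]

/-- If for most `x` all patterns in `x` are distributed to the sites, and the share of a site
depends only on the edges through the site and on a short key, then the keys are not that short. -/
theorem pow_le_of_shares {κ : Type*} [Fintype κ] (X : Finset (Finset (Code d q)))
    (Q : Finset (Code d q) → Site d q → Set (Pattern d q)) (key : Site d q → Finset (Code d q) → κ)
    (M : ℕ) (hX : 15 * 2 ^ Fintype.card (Code d q) ≤ 16 * X.card)
    (hcover : ∀ x ∈ X, ∀ p, (∀ i, side p i ∈ x) → ∃ w, p ∈ Q x w)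
    (hmem : ∀ x ∈ X, ∀ w, ∀ p ∈ Q x w, ∀ i, side p i ∈ x)
    (hdet : ∀ x ∈ X, ∀ y ∈ X, ∀ w, key w x = key w y →
      (∀ g, Meets w g → (g ∈ x ↔ g ∈ y)) → Q x w = Q y w)
    (hM : 32 * Fintype.card (Site d q) * Fintype.card κ ≤ 2 ^ M) :
    q ^ (d + 1) ≤ 288 * (d + 1) * M := by
  classical
  rcases Nat.eq_zero_or_pos q with rfl | hq
  · simp
  set N := Fintype.card (Code d q)
  set σ := Fintype.card (Site d q) with hσ
  set τ := Fintype.card (Pattern d q) with hτ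
  have hσpos : 0 < σ := by rw [hσ, card_site]; positivity
  -- `F w x` is the set of edges not through `w` that the share of `w` reveals; `Y w` is the set of
  -- inputs on which it has at least `M` elements.
  let F : Site d q → Finset (Code d q) → Finset (Code d q) := fun w x =>
    Finset.univ.filter fun g => ¬ Meets w g ∧ ∃ p ∈ Q x w, ∃ i, side p i = g
  let Y : Site d q → Finset (Finset (Code d q)) := fun w => X.filter fun x => M ≤ (F w x).card
  let cnt : Finset (Code d q) → ℕ := fun x =>
    (Finset.univ.filter fun p : Pattern d q => ∀ i, side p i ∈ x).card
  have hcnt_le : ∀ x, cnt x ≤ τ := fun x => Finset.card_le_univ _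
  have hY : ∀ w, 32 * σ * (Y w).card ≤ 2 ^ N := by
    intro w
    have h := card_mul_two_pow_le (Meets w) (Y w) (F w) (key w) M ?_ ?_ ?_ ?_
    · refine Nat.le_of_mul_le_mul_right ?_ (pow_pos (show 0 < 2 by norm_num) M)
      calc 32 * σ * (Y w).card * 2 ^ M = 32 * σ * ((Y w).card * 2 ^ M) := by ring
        _ ≤ 32 * σ * (Fintype.card κ * 2 ^ N) := Nat.mul_le_mul_left _ h
        _ = 2 ^ N * (32 * σ * Fintype.card κ) := by ring
        _ ≤ 2 ^ N * 2 ^ M := Nat.mul_le_mul_left _ hM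
    · intro x hx g hg
      obtain ⟨-, p, hp, i, rfl⟩ := (Finset.mem_filter.1 hg).2
      exact hmem x (Finset.mem_filter.1 hx).1 w p hp i
    · exact fun x _ g hg => (Finset.mem_filter.1 hg).2.1
    · intro x hx y hy hk ho
      have := hdet x (Finset.mem_filter.1 hx).1 y (Finset.mem_filter.1 hy).1 w hk fun g hg => by
        have := Finset.ext_iff.1 ho g
        simpa [hg] using this
      simp only [F, this]
    · exact fun x hx => (Finset.mem_filter.1 hx).2
  have hYU : 32 * (Finset.univ.biUnion Y).card ≤ 2 ^ N := by
    refine Nat.le_of_mul_le_mul_left ?_ hσpos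
    calc σ * (32 * (Finset.univ.biUnion Y).card)
        ≤ σ * (32 * ∑ w, (Y w).card) := by gcongr; exact Finset.card_biUnion_le
      _ = ∑ w, 32 * σ * (Y w).card := by rw [← Finset.mul_sum]; ring
      _ ≤ ∑ _w : Site d q, 2 ^ N := Finset.sum_le_sum fun w _ => hY w
      _ = σ * 2 ^ N := by simp [hσ, Finset.card_univ]
  -- Outside the exceptional inputs each of the `σ` sites reveals at most `M` foreign edges, and
  -- each of these is one of the three sides of at most `q ^ (2 * d + 1)` patterns.
  set L := σ * (M * (3 * q ^ (2 * d + 1))) with hL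
  have hok : ∀ x ∈ X, x ∉ Finset.univ.biUnion Y → cnt x ≤ L := by
    intro x hx hxY
    have hF : ∀ w, (F w x).card ≤ M := by
      intro w
      by_contra h
      exact hxY (Finset.mem_biUnion.2 ⟨w, Finset.mem_univ _,
        Finset.mem_filter.2 ⟨hx, (not_le.1 h).le⟩⟩)
    have hsub : (Finset.univ.filter fun p : Pattern d q => ∀ i, side p i ∈ x) ⊆
        Finset.univ.biUnion fun w => (F w x).biUnion fun g => Finset.univ.biUnion fun i =>
          Finset.univ.filter fun p : Pattern d q => side p i = g := by
      intro p hp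
      obtain ⟨w, hw⟩ := hcover x hx p (Finset.mem_filter.1 hp).2
      obtain ⟨i, hi⟩ := exists_type_not_meets w
      simp only [Finset.mem_biUnion, Finset.mem_univ, true_and, Finset.mem_filter]
      exact ⟨w, side p i, Finset.mem_filter.2 ⟨Finset.mem_univ _, hi _ rfl, p, hw, i, rfl⟩, i, rfl⟩
    refine (Finset.card_le_card hsub).trans ?_
    refine (Finset.card_biUnion_le_card_mul _ _ (M * (3 * q ^ (2 * d + 1))) fun w _ => ?_)
    refine (Finset.card_biUnion_le_card_mul _ _ (3 * q ^ (2 * d + 1)) fun g _ => ?_).trans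
      (Nat.mul_le_mul_right _ (hF w))
    exact Finset.card_biUnion_le_card_mul _ _ _ fun i _ => card_filter_side_eq_le i g
  have hsum : (∑ x, cnt x) * 8 = τ * 2 ^ N := by
    have : ∑ x, cnt x = ∑ p : Pattern d q,
        (Finset.univ.filter fun x : Finset (Code d q) => ∀ i, side p i ∈ x).card := by
      simp only [cnt, Finset.card_filter]
      exact Finset.sum_comm
    rw [this, Finset.sum_mul, Finset.sum_congr rfl fun p _ => card_filter_side_mem p]
    simp [hτ, Finset.card_univ, N]
  have hsum_le : ∑ x, cnt x ≤ 2 ^ N * L + (Xᶜ.card + (Finset.univ.biUnion Y).card) * τ := by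
    have h1 : ∀ x, cnt x ≤ L + ((if x ∈ Xᶜ then τ else 0) +
        (if x ∈ Finset.univ.biUnion Y then τ else 0)) := by
      intro x
      by_cases hx : x ∈ X
      · by_cases hxY : x ∈ Finset.univ.biUnion Y
        · rw [if_pos hxY]
          have := hcnt_le x
          omega
        · exact (hok x hx hxY).trans (Nat.le_add_right _ _)
      · rw [if_pos (Finset.mem_compl.2 hx)]
        have := hcnt_le x
        omega
    refine (Finset.sum_le_sum fun x _ => h1 x).trans (le_of_eq ?_)
    rw [Finset.sum_add_distrib, Finset.sum_add_distrib, ← Finset.sum_filter, ← Finset.sum_filter]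
    simp only [Finset.filter_univ_mem, Finset.sum_const, Finset.card_univ, Fintype.card_finset,
      smul_eq_mul]
    ring
  have hXc : 16 * Xᶜ.card ≤ 2 ^ N := by
    have := Finset.card_add_card_compl X
    rw [Fintype.card_finset] at this
    change _ = 2 ^ N at this
    omega
  -- The average of `cnt` is `τ / 8`. Exceptional inputs contribute at most `(1/16 + 1/32) * τ` to
  -- it, so `L` must cover the remaining `τ / 32`.
  have hτL : τ ≤ 32 * L := by
    have h2 : 0 < 2 ^ N := by positivity
    refine Nat.le_of_mul_le_mul_left ?_ h2
    have h3 : 32 * (Xᶜ.card + (Finset.univ.biUnion Y).card) * τ ≤ 3 * 2 ^ N * τ :=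
      Nat.mul_le_mul_right _ (by omega)
    nlinarith
  refine Nat.le_of_mul_le_mul_right ?_ (pow_pos hq (2 * d + 2))
  calc q ^ (d + 1) * q ^ (2 * d + 2) = τ := by rw [hτ, card_pattern]; ring
    _ ≤ 32 * L := hτL
    _ = 288 * (d + 1) * M * q ^ (2 * d + 2) := by rw [hL, hσ, card_site]; ring

end LayeredHypergraph

namespace PCAlgorithm

variable {n B : ℕ} {Ω : Type*} [MeasurableSpace Ω]

/-! ### Shares of the vertices -/

open Classical in
/-- The messages that `v` receives in round `t + 1`. -/
noncomputable def received (A : PCAlgorithm n B Ω) (H : Hypergraph (Fin n)) (ω : Ω) (t : ℕ)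
    (v u : Fin n) : PCMessage B :=
  if u ≠ v ∧ H.Adj u v then A.send u (H.incidentEdges u) ω (A.history H ω t u) v else none

theorem history_succ (A : PCAlgorithm n B Ω) (H : Hypergraph (Fin n)) (ω : Ω) (t : ℕ) (v : Fin n) :
    A.history H ω (t + 1) v = A.received H ω t v :: A.history H ω t v := rfl

theorem drop_history (A : PCAlgorithm n B Ω) (H : Hypergraph (Fin n)) (ω : Ω) (v : Fin n)
    (t s : ℕ) : (A.history H ω (t + s) v).drop s = A.history H ω t v := by
  induction s with
  | zero => rfl
  | succ s ih => rw [← add_assoc, history_succ, List.drop_succ_cons, ih]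

/-- Every vertex has output after at most `T` rounds. -/
def DoneBy (A : PCAlgorithm n B Ω) (H : Hypergraph (Fin n)) (ω : Ω) (T : ℕ) : Prop :=
  ∀ v, ∃ s ≤ T, ∃ S, A.Answers H ω v s S

/-- The triangles that `v` has output after `T` rounds. -/
def share (A : PCAlgorithm n B Ω) (H : Hypergraph (Fin n)) (ω : Ω) (T : ℕ) (v : Fin n) :
    Set (HyperTriangle n) :=
  {τ | ∃ t ≤ T, ∃ S, A.Answers H ω v t S ∧ τ ∈ S}

theorem Answers.unique {A : PCAlgorithm n B Ω} {H : Hypergraph (Fin n)} {ω : Ω} {v : Fin n}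
    {s t : ℕ} {R S : Set (HyperTriangle n)} (h : A.Answers H ω v s R) (h' : A.Answers H ω v t S) :
    s = t ∧ R = S := by
  have hst : s = t := by
    rcases lt_trichotomy s t with hlt | rfl | hlt
    · simpa [h.1] using h'.2 s hlt
    · rfl
    · simpa [h'.1] using h.2 t hlt
  subst hst
  exact ⟨rfl, Option.some_injective _ (h.1.symm.trans h'.1)⟩

/-- Earlier histories are suffixes of the history at time `T`, so the latter determines all outputs
up to `T`. -/
theorem share_congr (A : PCAlgorithm n B Ω) {H H' : Hypergraph (Fin n)} (ω : Ω) {T : ℕ} {v : Fin n}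
    (hinc : H.incidentEdges v = H'.incidentEdges v)
    (hhist : A.history H ω T v = A.history H' ω T v) :
    A.share H ω T v = A.share H' ω T v := by
  have hout : ∀ t ≤ T, A.outputAt H ω v t = A.outputAt H' ω v t := by
    intro t ht
    obtain ⟨s, rfl⟩ := Nat.exists_eq_add_of_le ht
    rw [outputAt, outputAt, hinc, ← A.drop_history H ω v t s, hhist, drop_history]
  have hans : ∀ t ≤ T, ∀ S, A.Answers H ω v t S ↔ A.Answers H' ω v t S := by
    intro t ht S
    rw [Answers, Answers, hout t ht]
    refine and_congr_right fun _ => forall₂_congr fun s hs => ?_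
    rw [hout s (hs.le.trans ht)]
  ext τ
  simp only [share, Set.mem_ofPred_eq]
  refine exists_congr fun t => and_congr_right fun ht => exists_congr fun S => ?_
  rw [hans t ht]

theorem Enumerates.iUnion_share {A : PCAlgorithm n B Ω} {k : TriangleKind} {H : Hypergraph (Fin n)}
    {ω : Ω} {T : ℕ} (h : A.Enumerates k H ω) (hT : A.DoneBy H ω T) :
    ⋃ v, A.share H ω T v = {τ | τ.IsTriangle H k} := by
  obtain ⟨S, hS, -, hU⟩ := h
  rw [← hU]
  refine Set.iUnion_congr fun v => ?_
  obtain ⟨t, ht⟩ := hS v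
  obtain ⟨s, hs, R, hR⟩ := hT v
  ext τ
  constructor
  · rintro ⟨t', -, S', h', hτ⟩
    rwa [(ht.unique h').2]
  · intro hτ
    rw [(ht.unique hR).2] at hτ
    exact ⟨s, hs, R, hR, hτ⟩

end PCAlgorithm

namespace LayeredHypergraph

variable {n d q B : ℕ} {Ω : Type*} [MeasurableSpace Ω]

/-! ### Executions on layered hypergraphs -/

theorem incidentEdges_of_not_mem_range {φ : Bool × Site d q → Fin n} {v : Fin n}
    (hv : ∀ w, φ (false, w) ≠ v) (x : Finset (Code d q)) :
    (network φ x).incidentEdges v = {e | e ∈ Set.range (edge φ true) ∧ v ∈ e} := by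
  ext e
  constructor
  · rintro ⟨⟨g, -, rfl⟩ | h, hve⟩
    · obtain ⟨p, hp⟩ := hve
      exact absurd hp (hv _)
    · exact ⟨h, hve⟩
  · exact fun h => ⟨Or.inr h.1, h.2⟩

theorem adj_of_not_mem_range {φ : Bool × Site d q → Fin n} {v u : Fin n}
    (hv : ∀ w, φ (false, w) ≠ v) (x : Finset (Code d q)) :
    (network φ x).Adj u v ↔ ∃ e ∈ Set.range (edge φ true), u ∈ e ∧ v ∈ e := by
  have h := Set.ext_iff.1 (incidentEdges_of_not_mem_range hv x)
  simp only [Hypergraph.incidentEdges, Set.mem_ofPred_eq] at h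
  constructor
  · rintro ⟨e, he, hu, hve⟩
    exact ⟨e, ((h e).1 ⟨he, hve⟩).1, hu, hve⟩
  · rintro ⟨e, he, hu, hve⟩
    exact ⟨e, ((h e).2 ⟨he, hve⟩).1, hu, hve⟩

/-- Neighbours of a vertex outside the first copy are also outside it, and the edges there do not
depend on `x`. -/
theorem history_of_not_mem_range (A : PCAlgorithm n B Ω) (ω : Ω) {φ : Bool × Site d q → Fin n}
    (hφ : Function.Injective φ) (x y : Finset (Code d q)) (t : ℕ) {v : Fin n}
    (hv : ∀ w, φ (false, w) ≠ v) :
    A.history (network φ x) ω t v = A.history (network φ y) ω t v := by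
  induction t generalizing v with
  | zero => rfl
  | succ t ih =>
    rw [A.history_succ, A.history_succ, ih hv]
    congr 1
    funext u
    have hadj : (network φ x).Adj u v ↔ (network φ y).Adj u v := by
      rw [adj_of_not_mem_range hv, adj_of_not_mem_range hv]
    rw [PCAlgorithm.received, PCAlgorithm.received]
    by_cases h : u ≠ v ∧ (network φ x).Adj u v
    · have hu : ∀ w, φ (false, w) ≠ u := by
        obtain ⟨e, ⟨g, rfl⟩, ⟨p, hp⟩, -⟩ := (adj_of_not_mem_range hv x).1 h.2
        intro w hw
        exact absurd (congrArg Prod.fst (hφ (hw.trans hp.symm))) (by simp)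
      rw [if_pos h, if_pos ⟨h.1, hadj.1 h.2⟩, ih hu, incidentEdges_of_not_mem_range hu,
        incidentEdges_of_not_mem_range hu]
    · rw [if_neg h, if_neg fun h' => h ⟨h'.1, hadj.2 h'.2⟩]

theorem incidentEdges_congr {φ : Bool × Site d q → Fin n} (hφ : Function.Injective φ)
    {x y : Finset (Code d q)} {w : Site d q} (h : ∀ g, Meets w g → (g ∈ x ↔ g ∈ y)) :
    (network φ x).incidentEdges (φ (false, w)) = (network φ y).incidentEdges (φ (false, w)) := by
  have key : ∀ x y : Finset (Code d q), (∀ g, Meets w g → (g ∈ x ↔ g ∈ y)) →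
      (network φ x).incidentEdges (φ (false, w)) ⊆ (network φ y).incidentEdges (φ (false, w)) := by
    rintro x y h _ ⟨⟨g, hg, rfl⟩ | hr, hw⟩
    · exact ⟨Or.inl ⟨g, (h g ((meets_iff hφ).1 hw)).1 hg, rfl⟩, hw⟩
    · exact ⟨Or.inr hr, hw⟩
  exact (key x y h).antisymm (key y x fun g hg => (h g hg).symm)

theorem exists_of_adj {φ : Bool × Site d q → Fin n} (hφ : Function.Injective φ)
    {x : Finset (Code d q)} {w : Site d q} {u : Fin n} (h : (network φ x).Adj u (φ (false, w))) :
    ∃ w', φ (false, w') = u := by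
  obtain ⟨_, ⟨g, -, rfl⟩ | ⟨g, rfl⟩, ⟨p, rfl⟩, hw⟩ := h
  · exact ⟨_, rfl⟩
  · exact absurd ((mem_edge hφ).1 hw).1 (by simp)

/-- The messages that the site `w` receives from the other sites in the first `T` rounds. -/
noncomputable def transcript (A : PCAlgorithm n B Ω) (ω : Ω) (T : ℕ)
    (φ : Bool × Site d q → Fin n) (w : Site d q) (x : Finset (Code d q)) :
    Fin T → Site d q → PCMessage B :=
  fun t w' => A.received (network φ x) ω t (φ (false, w)) (φ (false, w'))

theorem history_eq_of_transcript_eq (A : PCAlgorithm n B Ω) (ω : Ω) (T : ℕ)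
    {φ : Bool × Site d q → Fin n} (hφ : Function.Injective φ) {x y : Finset (Code d q)}
    {w : Site d q} (h : transcript A ω T φ w x = transcript A ω T φ w y) :
    A.history (network φ x) ω T (φ (false, w)) = A.history (network φ y) ω T (φ (false, w)) := by
  have key : ∀ t ≤ T, A.history (network φ x) ω t (φ (false, w)) =
      A.history (network φ y) ω t (φ (false, w)) := by
    intro t
    induction t with
    | zero => exact fun _ => rfl
    | succ t ih =>
      intro ht
      rw [A.history_succ, A.history_succ, ih (Nat.le_of_succ_le ht)]
      congr 1
      funext u
      by_cases hu : ∃ w', φ (false, w') = u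
      · obtain ⟨w', rfl⟩ := hu
        exact congrFun (congrFun h ⟨t, ht⟩) w'
      · rw [PCAlgorithm.received, PCAlgorithm.received,
          if_neg fun h => hu (exists_of_adj hφ h.2), if_neg fun h => hu (exists_of_adj hφ h.2)]
  exact key T le_rfl

theorem two_pow_transcripts (σ B T : ℕ) :
    32 * σ * ((2 ^ B + 1) ^ σ) ^ T ≤ 2 ^ (5 + σ + (B + 1) * σ * T) := by
  rw [pow_add, pow_add, pow_mul, pow_mul]
  have h1 : σ ≤ 2 ^ σ := Nat.lt_two_pow_self.le
  have h2 : 2 ^ B + 1 ≤ 2 ^ (B + 1) := by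
    have := Nat.one_le_two_pow (n := B)
    rw [pow_succ]
    omega
  norm_num only
  gcongr

/-- If a fixed execution enumerates the triangles of most layered hypergraphs within `T` rounds,
then `T` is large. -/
theorem pow_le_of_enumerates (A : PCAlgorithm n B Ω) (ω : Ω) (T : ℕ) (k : TriangleKind)
    {φ : Bool × Site d q → Fin n} (hφ : Function.Injective φ)
    (hlt : ∀ i j : Fin 3, i < j → ∀ a b, φ (false, .inl i, a) < φ (false, .inl j, b))
    (X : Finset (Finset (Code d q))) (hX : 15 * 2 ^ Fintype.card (Code d q) ≤ 16 * X.card)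
    (hgood : ∀ x ∈ X, A.Enumerates k (network φ x) ω ∧ A.DoneBy (network φ x) ω T) :
    q ^ (d + 1) ≤ 288 * (d + 1) *
      (5 + 3 * (d + 1) * q + (B + 1) * (3 * (d + 1) * q) * T) := by
  classical
  have hshare : ∀ x ∈ X, ⋃ v, A.share (network φ x) ω T v = {τ | τ.IsTriangle (network φ x) k} :=
    fun x hx => (hgood x hx).1.iUnion_share (hgood x hx).2
  have hmem : ∀ x ∈ X, ∀ v p, triangle φ p ∈ A.share (network φ x) ω T v → ∀ i, side p i ∈ x :=
    fun x hx v p hp => side_mem_of_isTriangle hφ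
      ((Set.ext_iff.1 (hshare x hx) _).1 (Set.mem_iUnion.2 ⟨v, hp⟩))
  refine pow_le_of_shares X
    (fun x w => {p | triangle φ p ∈ A.share (network φ x) ω T (φ (false, w))})
    (transcript A ω T φ) _ hX ?_ (fun x hx w p hp => hmem x hx _ p hp) ?_ ?_
  · intro x hx p hp
    obtain ⟨v, hv⟩ := Set.mem_iUnion.1
      ((Set.ext_iff.1 (hshare x hx) _).2 (isTriangle_triangle hφ hlt hp k))
    by_cases hw : ∃ w, φ (false, w) = v
    · obtain ⟨w, rfl⟩ := hw
      exact ⟨w, hv⟩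
    · exfalso
      push Not at hw
      -- A vertex outside the first copy outputs the same share for every input in `X`. A pattern
      -- output there would be present in at least 15/16 of all inputs, yet it is present in only
      -- 1/8 of them.
      have hsub : X ⊆ Finset.univ.filter fun y : Finset (Code d q) => ∀ i, side p i ∈ y := by
        intro y hy
        refine Finset.mem_filter.2 ⟨Finset.mem_univ _, hmem y hy v p ?_⟩
        rwa [A.share_congr ω (H' := network φ x) (by
          rw [incidentEdges_of_not_mem_range hw, incidentEdges_of_not_mem_range hw])
          (history_of_not_mem_range A ω hφ y x T hw)]
      have h1 := Finset.card_le_card hsub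
      have h2 := card_filter_side_mem p
      have h3 : 0 < 2 ^ Fintype.card (Code d q) := by positivity
      omega
  · intro x _ y _ w hk ho
    ext p
    simp only [Set.mem_ofPred_eq]
    rw [A.share_congr ω (incidentEdges_congr hφ ho) (history_eq_of_transcript_eq A ω T hφ hk)]
  · rw [card_site]
    simp only [Fintype.card_fun, Fintype.card_fin, Fintype.card_option, Fintype.card_bool,
      card_site]
    exact two_pow_transcripts _ _ _

end LayeredHypergraph

/-- Finiteness makes the unions over output sets in the measurability proofs countable. -/
instance HyperTriangle.instFinite (n : ℕ) : Finite (HyperTriangle n) :=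
  Finite.of_injective (fun T : HyperTriangle n => (T.v, T.e)) fun S T h => by
    simp only [Prod.mk.injEq] at h
    exact HyperTriangle.ext h.1 h.2

namespace PCAlgorithm

variable {n B : ℕ} {Ω : Type*} [MeasurableSpace Ω]

/-! ### Measurability -/

/-- There are only countably many histories, so one can split according to the sender's history, for
which `send` is measurable. -/
theorem measurableSet_history (A : PCAlgorithm n B Ω) (H : Hypergraph (Fin n)) (t : ℕ) (v : Fin n)
    (h : PCHistory n B) : MeasurableSet {ω | A.history H ω t v = h} := by
  induction t generalizing v h with
  | zero => exact MeasurableSet.const ([] = h)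
  | succ t ih =>
    simp only [history_succ]
    cases h with
    | nil => simp
    | cons m h =>
      simp only [List.cons.injEq, funext_iff, Set.ofPred_and, Set.ofPred_forall]
      refine (MeasurableSet.iInter fun u => ?_).inter (ih v h)
      by_cases hu : u ≠ v ∧ H.Adj u v
      · have : {ω | A.received H ω t v u = m u} = ⋃ h' : PCHistory n B,
            {ω | A.history H ω t u = h'} ∩ {ω | A.send u (H.incidentEdges u) ω h' v = m u} := by
          ext ω
          simp [received, if_pos hu]
        rw [this]
        exact MeasurableSet.iUnion fun h' => (ih u h').inter (A.measurableSet_send _ _ _ _ _)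
      · simp only [received, if_neg hu]
        exact MeasurableSet.const _

theorem measurableSet_outputAt (A : PCAlgorithm n B Ω) (H : Hypergraph (Fin n)) (v : Fin n) (t : ℕ)
    (S : Option (Set (HyperTriangle n))) : MeasurableSet {ω | A.outputAt H ω v t = S} := by
  have : {ω | A.outputAt H ω v t = S} = ⋃ h : PCHistory n B,
      {ω | A.history H ω t v = h} ∩ {ω | A.output v (H.incidentEdges v) ω h = S} := by
    ext ω
    simp [outputAt]
  rw [this]
  exact MeasurableSet.iUnion fun h =>
    (A.measurableSet_history H t v h).inter (A.measurableSet_output _ _ _ _)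

theorem measurableSet_answers (A : PCAlgorithm n B Ω) (H : Hypergraph (Fin n)) (v : Fin n) (t : ℕ)
    (S : Set (HyperTriangle n)) : MeasurableSet {ω | A.Answers H ω v t S} := by
  simp only [Answers, Set.ofPred_and, Set.ofPred_forall]
  exact (A.measurableSet_outputAt H v t _).inter (MeasurableSet.iInter fun s =>
    MeasurableSet.iInter fun _ => A.measurableSet_outputAt H v s _)

theorem measurableSet_enumerates (A : PCAlgorithm n B Ω) (k : TriangleKind)
    (H : Hypergraph (Fin n)) : MeasurableSet {ω | A.Enumerates k H ω} := by
  simp only [Enumerates, Set.ofPred_exists, Set.ofPred_and, Set.ofPred_forall]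
  exact MeasurableSet.iUnion fun S => (MeasurableSet.iInter fun v => MeasurableSet.iUnion fun t =>
    A.measurableSet_answers H v t _).inter ((MeasurableSet.const _).inter (MeasurableSet.const _))

theorem measurableSet_doneBy (A : PCAlgorithm n B Ω) (H : Hypergraph (Fin n)) (T : ℕ) :
    MeasurableSet {ω | A.DoneBy H ω T} := by
  simp only [DoneBy, Set.ofPred_exists, Set.ofPred_and, Set.ofPred_forall]
  exact MeasurableSet.iInter fun v => MeasurableSet.iUnion fun s => (MeasurableSet.const _).inter
    (MeasurableSet.iUnion fun S => A.measurableSet_answers H v s S)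

/-! ### Typical executions -/

theorem le_rounds_of_not_doneBy (A : PCAlgorithm n B Ω) {H : Hypergraph (Fin n)} {ω : Ω} {T : ℕ}
    (h : ¬ A.DoneBy H ω T) : ((T + 1 : ℕ) : ENNReal) ≤ A.rounds H ω := by
  refine le_iInf fun t => le_iInf fun ht => ?_
  by_contra hlt
  refine h fun v => ?_
  obtain ⟨s, hs, hS⟩ := ht v
  refine ⟨s, ?_, hS⟩
  have : t < T + 1 := by exact_mod_cast not_le.1 hlt
  omega

/-- Markov's inequality, by comparison with an indicator; measurability of `rounds` is not needed.
-/
theorem mul_measure_not_doneBy_le (A : PCAlgorithm n B Ω) (P : Measure Ω) (H : Hypergraph (Fin n))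
    (T : ℕ) : ((T + 1 : ℕ) : ENNReal) * P {ω | A.DoneBy H ω T}ᶜ ≤ A.expectedRounds P H := by
  rw [← lintegral_indicator_const (A.measurableSet_doneBy H T).compl]
  refine lintegral_mono fun ω => ?_
  by_cases h : A.DoneBy H ω T
  · simp [h]
  · simpa [h] using A.le_rounds_of_not_doneBy h

/-- Failure and lateness each cost at most 1/32, the latter by Markov. -/
theorem le_measure_enumerates_doneBy (A : PCAlgorithm n B Ω) (P : Measure Ω)
    [IsProbabilityMeasure P] {k : TriangleKind} {H : Hypergraph (Fin n)} {ρ : ℝ} {T : ℕ}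
    (hρ : 0 ≤ ρ) (hT : 32 * ρ < T + 1) (hsol : A.SolvesWithProb P k (31 / 32) H)
    (hexp : A.expectedRounds P H < ENNReal.ofReal ρ) :
    15 / 16 ≤ P.real {ω | A.Enumerates k H ω ∧ A.DoneBy H ω T} := by
  have h1 : 31 / 32 ≤ P.real {ω | A.Enumerates k H ω} :=
    (ENNReal.ofReal_le_iff_le_toReal (measure_ne_top _ _)).1 hsol
  have h2 : (T + 1) * P.real {ω | A.DoneBy H ω T}ᶜ ≤ ρ := by
    have := ENNReal.toReal_mono ENNReal.ofReal_ne_top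
      ((A.mul_measure_not_doneBy_le P H T).trans hexp.le)
    rw [ENNReal.toReal_mul, ENNReal.toReal_ofReal hρ, ENNReal.toReal_natCast] at this
    exact_mod_cast this
  have h3 : P.real {ω | A.DoneBy H ω T}ᶜ ≤ 1 / 32 := by
    have hpos : (0 : ℝ) < T + 1 := by positivity
    by_contra hlt
    nlinarith [not_le.1 hlt]
  have h4 : P.real {ω | A.Enumerates k H ω} ≤
      P.real {ω | A.Enumerates k H ω ∧ A.DoneBy H ω T} + P.real {ω | A.DoneBy H ω T}ᶜ := by
    refine (measureReal_mono fun ω hω => ?_).trans (measureReal_union_le _ _)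
    by_cases h : A.DoneBy H ω T
    · exact Or.inl ⟨hω, h⟩
    · exact Or.inr h
  linarith

end PCAlgorithm

/-- Some point lies in at least the average number of events. -/
theorem exists_le_card_filter_mem {Ω ι : Type*} [MeasurableSpace Ω] [Fintype ι] (P : Measure Ω)
    [IsProbabilityMeasure P] (G : ι → Set Ω) (hG : ∀ i, MeasurableSet (G i)) {p : ℝ}
    (hp : ∀ i, p ≤ P.real (G i)) [∀ ω, DecidablePred fun i => ω ∈ G i] :
    ∃ ω, p * Fintype.card ι ≤ (Finset.univ.filter fun i => ω ∈ G i).card := by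
  have hint : ∀ i, Integrable ((G i).indicator fun _ => (1 : ℝ)) P := fun i =>
    (integrable_const 1).indicator (hG i)
  obtain ⟨ω, hω⟩ := exists_integral_le
    (f := fun ω => ∑ i, (G i).indicator (fun _ => (1 : ℝ)) ω)
    (integrable_finsetSum _ fun i _ => hint i)
  refine ⟨ω, ?_⟩
  rw [integral_finsetSum _ fun i _ => hint i] at hω
  have h1 : p * Fintype.card ι ≤ ∑ i, ∫ ω, (G i).indicator (fun _ => (1 : ℝ)) ω ∂P := by
    rw [mul_comm, ← nsmul_eq_mul, ← Finset.card_univ]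
    refine Finset.card_nsmul_le_sum _ _ _ fun i _ => ?_
    rw [integral_indicator_const _ (hG i)]
    simpa using hp i
  refine (h1.trans hω).trans (le_of_eq ?_)
  simp [Set.indicator_apply]

namespace LayeredHypergraph

variable {n d q B : ℕ} {Ω : Type*} [MeasurableSpace Ω]

/-- The round bound for an algorithm that is correct and fast on all layered hypergraphs. -/
theorem pow_le_of_solvesWithProb (A : PCAlgorithm n B Ω) (P : Measure Ω) [IsProbabilityMeasure P]
    (k : TriangleKind) {φ : Bool × Site d q → Fin n} (hφ : Function.Injective φ)
    (hlt : ∀ i j : Fin 3, i < j → ∀ a b, φ (false, .inl i, a) < φ (false, .inl j, b))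
    {ρ : ℝ} {T : ℕ} (hρ : 0 ≤ ρ) (hT : 32 * ρ < T + 1)
    (hsol : ∀ x, A.SolvesWithProb P k (31 / 32) (network φ x))
    (hexp : ∀ x, A.expectedRounds P (network φ x) < ENNReal.ofReal ρ) :
    q ^ (d + 1) ≤ 288 * (d + 1) *
      (5 + 3 * (d + 1) * q + (B + 1) * (3 * (d + 1) * q) * T) := by
  classical
  -- One seed is good for at least 15/16 of the inputs; from here on the execution is deterministic.
  obtain ⟨ω, hω⟩ := exists_le_card_filter_mem P
    (fun x : Finset (Code d q) =>
      {ω | A.Enumerates k (network φ x) ω ∧ A.DoneBy (network φ x) ω T})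
    (fun x => (A.measurableSet_enumerates k _).inter (A.measurableSet_doneBy _ T))
    (fun x => A.le_measure_enumerates_doneBy P hρ hT (hsol x) (hexp x))
  refine pow_le_of_enumerates A ω T k hφ hlt (Finset.univ.filter fun x =>
    A.Enumerates k (network φ x) ω ∧ A.DoneBy (network φ x) ω T) ?_
    fun x hx => (Finset.mem_filter.1 hx).2
  rw [← Fintype.card_finset]
  have h16 := mul_le_mul_of_nonneg_left hω (show (0 : ℝ) ≤ 16 by norm_num)
  rw [← mul_assoc, show (16 : ℝ) * (15 / 16) = 15 by norm_num] at h16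
  exact_mod_cast h16

end LayeredHypergraph

namespace LayeredHypergraph

/-! ### Placement of the sites and choice of parameters -/

/-- The two copies of the site space fit into `Fin n`, with the corner layers in order. -/
theorem exists_placement {n d q : ℕ} (h : 6 * (d + 1) * q ≤ n) :
    ∃ φ : Bool × Site d q → Fin n, Function.Injective φ ∧
      ∀ i j : Fin 3, i < j → ∀ a b, φ (false, .inl i, a) < φ (false, .inl j, b) := by
  let e : Site d q ≃ Fin ((3 + 3 * d) * q) := (Equiv.prodCongr
    ((Equiv.sumCongr (Equiv.refl _) finProdFinEquiv).trans finSumFinEquiv)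
      (Equiv.refl _)).trans finProdFinEquiv
  have hn : (3 + 3 * d) * q + (3 + 3 * d) * q ≤ n := by
    refine le_trans (le_of_eq ?_) h
    ring
  have hlt : ∀ (s : Bool) (w : Site d q), (if s then (3 + 3 * d) * q else 0) + (e w).1 < n := by
    intro s w
    have := (e w).2
    split_ifs <;> omega
  refine ⟨fun c => ⟨_, hlt c.1 c.2⟩, ?_, ?_⟩
  · rintro ⟨s, w⟩ ⟨t, v⟩ hst
    have h1 := (e w).2
    have h2 := (e v).2
    simp only [Fin.mk.injEq] at hst
    cases s <;> cases t <;> simp only [Bool.false_eq_true, if_true, if_false] at hst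
    · rw [e.injective (Fin.ext (show (e w).1 = (e v).1 by omega))]
    · omega
    · omega
    · rw [e.injective (Fin.ext (show (e w).1 = (e v).1 by omega))]
  · intro i j hij a b
    have h1 : (i : ℕ) + 1 ≤ j := hij
    have h2 := Nat.mul_le_mul_left q h1
    have h3 := a.2
    simp only [Fin.mk_lt_mk, Bool.false_eq_true, if_false, e, Equiv.trans_apply,
      Equiv.prodCongr_apply, Prod.map, Equiv.sumCongr_apply, Sum.map_inl, Equiv.refl_apply,
      finSumFinEquiv_apply_left, finProdFinEquiv_apply_val, Fin.val_castAdd]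
    rw [mul_add] at h2
    omega

/-- The layer size that belongs to the density bound `μ`. -/
theorem exists_layer_size {R q₀ : ℕ} (hR : R ≠ 0) {D μ : ℝ} (hD : 0 < D)
    (hμ : D * (q₀ + 1) ^ R ≤ μ) :
    ∃ q : ℕ, q₀ ≤ q ∧ D * (q + 1) ^ R ≤ μ ∧ μ < D * (q + 2) ^ R := by
  have hex : ∃ m : ℕ, μ < D * ((m : ℝ) + 2) ^ R := by
    obtain ⟨m, hm⟩ := exists_nat_gt (μ / D)
    refine ⟨m, ?_⟩
    rw [div_lt_iff₀' hD] at hm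
    refine hm.trans_le (mul_le_mul_of_nonneg_left ?_ hD.le)
    have h1 : (m : ℝ) + 2 ≤ (m + 2) ^ R := le_self_pow₀ (by linarith [m.cast_nonneg (α := ℝ)]) hR
    linarith
  classical
  -- By minimality of `q` the upper bound on `μ` fails at `q - 1`, which is the wanted lower bound;
  -- for `q = 0` it is `hμ`.
  obtain ⟨hq, hmin⟩ := (Nat.find_eq_iff hex).1 rfl
  set q := Nat.find hex
  have hq₀ : q₀ ≤ q := by
    by_contra hlt
    have h1 : (q : ℝ) + 2 ≤ q₀ + 1 := by
      have : q + 2 ≤ q₀ + 1 := by omega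
      exact_mod_cast this
    have h2 : D * ((q : ℝ) + 2) ^ R ≤ D * (q₀ + 1) ^ R := by gcongr
    linarith
  refine ⟨q, hq₀, ?_, hq⟩
  rcases Nat.eq_zero_or_pos q with h0 | hpos
  · have : q₀ = 0 := by omega
    rw [h0]
    rw [this] at hμ
    exact hμ
  · have := hmin (q - 1) (by omega)
    rw [not_lt, Nat.cast_sub hpos] at this
    push_cast at this
    rwa [show (q : ℝ) - 1 + 2 = q + 1 by ring] at this

/-- Here `1 - ε ≤ d / (d + 1)` and `q + 2 ≤ 3 * q`. -/
theorem rpow_le_of_lt_layer_size {d q : ℕ} {D μ ε : ℝ} (hD : 1 ≤ D) (hμ : 1 ≤ μ)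
    (hε : 1 ≤ (d + 1) * ε) (hq : 1 ≤ q) (hle : μ ≤ D * (q + 2) ^ (d + 1)) :
    μ ^ (1 - ε) ≤ D * 3 ^ d * q ^ d := by
  have hd : (0 : ℝ) < d + 1 := by positivity
  have hq' : (1 : ℝ) ≤ q := by exact_mod_cast hq
  have h0 : (0 : ℝ) ≤ d / (d + 1) := by positivity
  have h1 : 1 - ε ≤ d / (d + 1) := by
    rw [le_div_iff₀ hd]
    nlinarith
  calc μ ^ (1 - ε) ≤ μ ^ ((d : ℝ) / (d + 1)) := Real.rpow_le_rpow_of_exponent_le hμ h1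
    _ ≤ (D * (3 * q) ^ (d + 1)) ^ ((d : ℝ) / (d + 1)) := by
        refine Real.rpow_le_rpow (by linarith) (hle.trans ?_) h0
        gcongr
        linarith
    _ = D ^ ((d : ℝ) / (d + 1)) * (3 * q) ^ d := by
        rw [Real.mul_rpow (by linarith) (by positivity), ← Real.rpow_natCast (3 * (q : ℝ)) (d + 1),
          ← Real.rpow_mul (by positivity)]
        congr 1
        rw [← Real.rpow_natCast (3 * (q : ℝ)) d]
        congr 1
        push_cast
        field_simp
    _ ≤ D ^ (1 : ℝ) * (3 * q) ^ d := by
        gcongr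
        rw [div_le_one hd]
        linarith
    _ = D * 3 ^ d * q ^ d := by rw [Real.rpow_one, mul_pow]; ring

/-- For large layers and few rounds, the round bound is violated. -/
theorem lt_pow_of_rounds_small {d q B T n : ℕ} {b c D μ ε ρ : ℝ} (hd : 1 ≤ d)
    (hq : 5000 * (d + 1) ^ 2 ≤ q) (hn : 2 ≤ n) (hb : 0 < b) (hB : (B : ℝ) ≤ b * Real.log n)
    (hc : 0 < c) (hcC : c * (110592 * (d + 1) ^ 2 * (b + 2) * D * 3 ^ d) ≤ 1)
    (hμ : 0 ≤ μ) (hμq : μ ^ (1 - ε) ≤ D * 3 ^ d * q ^ d)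
    (hρ : ρ = c * μ ^ (1 - ε) / Real.log n) (hT : (T : ℝ) ≤ 32 * ρ) :
    288 * (d + 1) * (5 + 3 * (d + 1) * q + (B + 1) * (3 * (d + 1) * q) * T) < q ^ (d + 1) := by
  have hlog : 1 / 2 ≤ Real.log n :=
    le_trans (show 1 / 2 ≤ Real.log 2 by linarith [Real.log_two_gt_d9])
      (Real.log_le_log (by norm_num) (by exact_mod_cast hn))
  have hlog0 : 0 < Real.log n := by linarith
  have hY : 0 ≤ μ ^ (1 - ε) := Real.rpow_nonneg hμ _
  -- `B + 1 ≤ (b + 2) * log n` since `log n ≥ 1 / 2`; the logarithm cancels against that in `ρ`.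
  have hBT : ((B : ℝ) + 1) * T ≤ 32 * c * (b + 2) * μ ^ (1 - ε) := by
    calc ((B : ℝ) + 1) * T ≤ ((b + 2) * Real.log n) * (32 * ρ) := by
          gcongr
          nlinarith
      _ = 32 * c * (b + 2) * μ ^ (1 - ε) := by
          rw [hρ]
          field_simp
  have hqR : 5000 * ((d : ℝ) + 1) ^ 2 ≤ q := by exact_mod_cast hq
  have hd1 : (1 : ℝ) ≤ (d : ℝ) + 1 := by linarith [d.cast_nonneg (α := ℝ)]
  have hq1 : (1 : ℝ) ≤ q := by nlinarith
  have hqsq : (q : ℝ) ^ 2 ≤ q ^ (d + 1) := pow_le_pow_right₀ hq1 (by omega)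
  -- `5000 ≥ 2 * 288 * 8` gives the half here; `110592 = 4 * 288 * 3 * 32` gives the quarter in
  -- `t2`.
  have t1 : 288 * ((d : ℝ) + 1) * (5 + 3 * (d + 1) * q) ≤ q ^ (d + 1) / 2 := by
    have h1 : 5 + 3 * ((d : ℝ) + 1) * q ≤ 8 * (d + 1) * q := by nlinarith
    have h2 : 288 * ((d : ℝ) + 1) * (5 + 3 * (d + 1) * q) ≤
        288 * ((d : ℝ) + 1) * (8 * (d + 1) * q) := by gcongr
    have h3 : 5000 * ((d : ℝ) + 1) ^ 2 * q ≤ q * q := by gcongr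
    nlinarith
  have t2 : 288 * ((d : ℝ) + 1) * (3 * (d + 1) * q) * ((B + 1) * T) ≤ q ^ (d + 1) / 4 := by
    calc 288 * ((d : ℝ) + 1) * (3 * (d + 1) * q) * ((B + 1) * T)
        ≤ 288 * ((d : ℝ) + 1) * (3 * (d + 1) * q) * (32 * c * (b + 2) * (D * 3 ^ d * q ^ d)) := by
          exact mul_le_mul_of_nonneg_left (hBT.trans (by gcongr)) (by positivity)
      _ = c * (110592 * (d + 1) ^ 2 * (b + 2) * D * 3 ^ d) * (q ^ (d + 1) / 4) := by ring
      _ ≤ 1 * (q ^ (d + 1) / 4) := by gcongr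
      _ = q ^ (d + 1) / 4 := one_mul _
  have hpos : (0 : ℝ) < q ^ (d + 1) := by positivity
  have : (288 * (d + 1) * (5 + 3 * (d + 1) * q + (B + 1) * (3 * (d + 1) * q) * T) : ℝ) <
      q ^ (d + 1) := by nlinarith
  exact_mod_cast this

end LayeredHypergraph

/-! ### The lower bound -/

open LayeredHypergraph in
theorem theorem4p7 :
    ∃ p₀ : ℝ, 0 < p₀ ∧ p₀ < 1 ∧
      ∀ ε : ℝ, 0 < ε → ∀ (K : ℕ) (b : ℝ), 0 < b →
        ∃ c a μ₀ : ℝ, 0 < c ∧ 0 < a ∧ 0 < μ₀ ∧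
          ∀ (n B : ℕ) (μ : ℝ), μ₀ ≤ μ → μ ≤ (n : ℝ) ^ K → (B : ℝ) ≤ b * Real.log n →
            ∀ (k : TriangleKind) (Ω : Type*) [MeasurableSpace Ω] (P : Measure Ω)
              [IsProbabilityMeasure P] (A : PCAlgorithm n B Ω),
              (∀ H : Hypergraph (Fin n), H.IsNetwork → a * μ ≤ H.maxDensity → H.maxDensity ≤ μ →
                A.SolvesWithProb P k p₀ H) →
              ∃ H : Hypergraph (Fin n), H.IsNetwork ∧ a * μ ≤ H.maxDensity ∧ H.maxDensity ≤ μ ∧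
                ENNReal.ofReal (c * μ ^ (1 - ε) / Real.log n) ≤ A.expectedRounds P H := by
  refine ⟨31 / 32, by norm_num, by norm_num, fun ε hε K b hb => ?_⟩
  obtain ⟨m, hm⟩ := exists_nat_gt (1 / ε)
  -- The term `m` makes the exponent loss `1 / (d + 1)` at most `ε`; the term `2 * K` makes the
  -- construction fit into `n` vertices.
  obtain ⟨d, hd⟩ : ∃ d, d = 2 * K + m + 1 := ⟨_, rfl⟩
  have hdε : 1 ≤ ((d : ℝ) + 1) * ε := by
    rw [div_lt_iff₀ hε] at hm
    have : (m : ℝ) ≤ d + 1 := by exact_mod_cast (show m ≤ d + 1 by omega)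
    nlinarith
  obtain ⟨D, hD⟩ : ∃ D : ℝ, D = 6 * (d + 2) := ⟨_, rfl⟩
  have hD1 : 1 ≤ D := by rw [hD]; linarith [d.cast_nonneg (α := ℝ)]
  set C : ℝ := 110592 * (d + 1) ^ 2 * (b + 2) * D * 3 ^ d with hC
  have hCpos : 0 < C := by positivity
  obtain ⟨q₀, hq₀⟩ : ∃ q₀ : ℕ, q₀ = 5000 * (d + 1) ^ 2 := ⟨_, rfl⟩
  have hdq₀ : 6 * (d + 1) ≤ q₀ :=
    hq₀ ▸ Nat.mul_le_mul (by norm_num) (Nat.le_self_pow two_ne_zero _)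
  refine ⟨1 / C, 1 / (D * 3 ^ (d + 1)), D * (q₀ + 1) ^ (d + 1), by positivity, by positivity,
    by positivity, ?_⟩
  intro n B μ hμ₀ hμK hB k Ω _ P _ A hA
  obtain ⟨q, hqq₀, hqμ, hμq⟩ := exists_layer_size (R := d + 1) (by omega) (by linarith) hμ₀
  have hq1 : 1 ≤ q := le_trans (by omega) hqq₀
  have hq1' : (1 : ℝ) ≤ q := by exact_mod_cast hq1
  have hqpow : (q : ℝ) ^ (d + 1) ≤ n ^ K := by
    calc (q : ℝ) ^ (d + 1) ≤ 1 * (q + 1) ^ (d + 1) := by rw [one_mul]; gcongr; linarith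
      _ ≤ D * (q + 1) ^ (d + 1) := by gcongr
      _ ≤ n ^ K := hqμ.trans hμK
  have h1μ : 1 < μ := by
    refine lt_of_lt_of_le ?_ hqμ
    have : (1 : ℝ) < (q + 1) ^ (d + 1) := one_lt_pow₀ (by linarith) (by omega)
    nlinarith
  have hK : K ≠ 0 := by
    rintro rfl
    rw [pow_zero] at hμK
    linarith
  -- `q ^ (2 * K) ≤ q ^ (d + 1) ≤ μ ≤ n ^ K`. One factor `q` then absorbs `6 * (d + 1)`.
  have hqn : q ^ 2 ≤ n := by
    refine (Nat.pow_le_pow_iff_left hK).1 ?_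
    rw [← pow_mul]
    refine (Nat.pow_le_pow_right hq1 (show 2 * K ≤ d + 1 by omega)).trans ?_
    exact_mod_cast hqpow
  have hnq : 6 * (d + 1) * q ≤ n := by
    refine le_trans ?_ hqn
    rw [sq]
    exact Nat.mul_le_mul_right _ (hdq₀.trans hqq₀)
  have hn : 2 ≤ n := le_trans (by nlinarith) hnq
  obtain ⟨φ, hφ, hlt⟩ := exists_placement hnq
  have hlow : ∀ x, 1 / (D * 3 ^ (d + 1)) * μ ≤ (network φ x).maxDensity := by
    intro x
    refine le_trans ?_ (le_maxDensity_network hφ x hq1)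
    rw [one_div, inv_mul_le_iff₀ (by positivity)]
    refine hμq.le.trans ?_
    rw [mul_assoc, ← mul_pow]
    gcongr
    linarith
  have hupp : ∀ x, (network φ x).maxDensity ≤ μ := fun x => 
    (maxDensity_network_le φ x).trans (hD ▸ hqμ)
  by_contra! hcon
  set ρ := 1 / C * μ ^ (1 - ε) / Real.log n with hρ
  have hρ0 : 0 ≤ ρ := by
    have : 0 ≤ Real.log n := Real.log_natCast_nonneg n
    positivity
  -- The time horizon is `T = ⌊32 * ρ⌋`.
  refine absurd (pow_le_of_solvesWithProb A P k hφ hlt hρ0 (Nat.lt_floor_add_one (32 * ρ))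
    (fun x => hA _ (isNetwork_network φ x) (hlow x) (hupp x))
    (fun x => hcon _ (isNetwork_network φ x) (hlow x) (hupp x))) (not_le.2 ?_)
  refine lt_pow_of_rounds_small (by omega) (hq₀ ▸ hqq₀) hn hb hB (by positivity) ?_ (by linarith)
    (rpow_le_of_lt_layer_size hD1 h1μ.le hdε hq1 hμq.le) hρ (Nat.floor_le (by positivity))
  rw [one_div, inv_mul_cancel₀ hCpos.ne']
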